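/- Let $X$ be a Polish space (a separable completely metrizable topological space), and let $d$ be any metric on $X$ compatible with its topology (not necessarily complete). A continuum in $X$ is a nonempty compact connected subset of $X$ (one-point sets are continua). For $\varepsilon>0$ let $\mathcal C_\varepsilon(X)$ be the set of continua in $X$ of $d$-diameter $<\varepsilon$, as a subspace of the hyperspace of nonempty compact subsets of $X$ with the Vietoris topology, and let $E_X^{CC,\varepsilon}$ be the relation on $X$ such that $(x,y)\in E_X^{CC,\varepsilon}$ if and only if there are $k\in\mathbb N$ and $K_0,\dots,K_k\in\mathcal C_\varepsilon(X)$ with $x\in K_0$, $y\in K_k$ and $K_i\cap K_{i+1}\neq\emptyset$ for $0\le i<k$. Let $E_X^{CC}=\bigcap_{\varepsilon>0}E_X^{CC,\varepsilon}$. For a metrizable space $Y$ let $E_Y^A$ be the relation on $Y$ such that $(x,y)\in E_Y^A$ if and only if $x=y$ or some arc in $Y$ (a subset homeomorphic to $[0,1]$) contains both $x$ and $y$. For relations $E$ on $S$ and $F$ on $T$, where $S,T$ carry their Borel $\sigma$-algebras, $E$ is Borel reducible to $F$ if there is a Borel map $f:S\to T$ with $(x,y)\in E\iff (f(x),f(y))\in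 F$ for all $x,y\in S$; $E$ and $F$ are Borel bireducible, written $E\sim_B F$, if each is Borel reducible to the other. Then, for every $\varepsilon>0$, $$E_X^{CC,\varepsilon}\sim_B E^A_{\mathcal C_\varepsilon(X)}.$$ Moreover, $$E_X^{CC}\sim_B\bigcap_{n\ge1}E^A_{\mathcal C_{1/n}(X)},$$ where the intersection is regarded as a relation on the space $\bigcap_{n\ge1}\mathcal C_{1/n}(X)$. -/

import Mathlib

open TopologicalSpace

/-- `E` is Borel reducible to `F`. -/
def BorelReducible {X Y : Type*} [MeasurableSpace X] [MeasurableSpace Y]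
    (E : X → X → Prop) (F : Y → Y → Prop) : Prop :=
  ∃ f : X → Y, Measurable f ∧ ∀ x y, E x y ↔ F (f x) (f y)

/-- `E` and `F` are Borel bireducible. -/
def BorelBireducible {X Y : Type*} [MeasurableSpace X] [MeasurableSpace Y]
    (E : X → X → Prop) (F : Y → Y → Prop) : Prop :=
  BorelReducible E F ∧ BorelReducible F E

/-- An arc in `Y`: a subset homeomorphic to `[0,1]`. -/
def IsArc {Y : Type*} [TopologicalSpace Y] (A : Set Y) : Prop :=
  Nonempty (A ≃ₜ unitInterval)

/-- The arc-connection relation on `Y`. One-point sets count as degenerate arcs, so that the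
relation is reflexive. -/
def ArcConn (Y : Type*) [TopologicalSpace Y] (x y : Y) : Prop :=
  x = y ∨ ∃ A : Set Y, IsArc A ∧ x ∈ A ∧ y ∈ A

/-- The hyperspace of nonempty compact sets, whose topology in Mathlib is the Vietoris topology,
carries the Borel `σ`-algebra; its subspaces carry the induced one, which is again Borel. -/
instance instMeasurableSpaceNonemptyCompacts (X : Type*) [TopologicalSpace X] :
    MeasurableSpace (NonemptyCompacts X) := borel _

instance instBorelSpaceNonemptyCompacts (X : Type*) [TopologicalSpace X] :
    BorelSpace (NonemptyCompacts X) := ⟨rfl⟩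

/-- The hyperspace of continua of diameter less than `ε`. -/
def smallContinua (X : Type*) [MetricSpace X] (ε : ℝ) : Set (NonemptyCompacts X) :=
  {K | IsConnected (K : Set X) ∧ Metric.diam (K : Set X) < ε}

/-- The `ε`-chain continuum-connection relation: `x` and `y` are joined by a finite chain
`K 0, …, K k` of continua of diameter less than `ε`, consecutive ones intersecting. -/
def EpsChainConn (X : Type*) [MetricSpace X] (ε : ℝ) (x y : X) : Prop :=
  ∃ (k : ℕ) (K : Fin (k + 1) → NonemptyCompacts X),
    (∀ i, K i ∈ smallContinua X ε) ∧ x ∈ K 0 ∧ y ∈ K (Fin.last k) ∧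
      ∀ i : Fin k, ((K i.castSucc : Set X) ∩ (K i.succ : Set X)).Nonempty

/-- The chain continuum-connection relation. -/
def ChainConn (X : Type*) [MetricSpace X] (x y : X) : Prop :=
  ∀ ε : ℝ, 0 < ε → EpsChainConn X ε x y

/-- The intersection over `n ≥ 1` (written `n + 1`, `n : ℕ`) of the arc-connection relations of
the spaces of continua of diameter less than `1 / n`. As a set of pairs it lies in the square of
the intersection of these spaces, and it is a relation on that intersection. -/
def InterArcConn (X : Type*) [MetricSpace X]
    (K L : ↥(⋂ n : ℕ, smallContinua X (1 / ((n : ℝ) + 1)))) : Prop :=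
  ∀ n : ℕ, ArcConn (smallContinua X (1 / ((n : ℝ) + 1)))
    ⟨K.1, Set.mem_iInter.1 K.2 n⟩ ⟨L.1, Set.mem_iInter.1 L.2 n⟩

/-!
The theorem rests on one equivalence: two continua `K` and `L` of diameter `< ε` lie on a common arc
of the hyperspace if and only if an `ε`-chain of continua leads from a given point of `K` to a given
point of `L`. The two reductions are then the map `x ↦ {x}` and a Borel choice of a point in every
compact set.

Chains give arcs. The continua between two continua `A ⊆ B` form a compact partially ordered space,
which is densely ordered by boundary bumping, so a Whitney map carries each of its maximal chains
homeomorphically onto an interval. Hence continua that meet are joined by an arc, through the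
singleton of a common point, and such arcs can be concatenated in a Hausdorff space.

Arcs give chains. The continua parametrized by a short piece of an arc have as union a continuum
whose diameter is still `< ε`.

The choice of a point is Borel because a separable metric space embeds into the Hilbert cube, which
is a continuous image of the Cantor set: in a compact set `K` take the point with the least possible
Cantor parameter. This parameter is `≤ a` exactly when `K` meets a certain closed set.
-/

open Set Filter Topology

section BoundaryBumping

variable {X : Type*} [TopologicalSpace X]

theorem isCompact_connectedComponentIn {Y : Set X} (hY : IsCompact Y) (x : X) :
    IsCompact (connectedComponentIn Y x) := by
  by_cases hx : x ∈ Y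
  · have := isCompact_iff_compactSpace.1 hY
    rw [connectedComponentIn_eq_image hx]
    exact isClosed_connectedComponent.isCompact.image continuous_subtype_val
  · simp only [connectedComponentIn_eq_empty hx, isCompact_empty]

variable [T2Space X]

theorem exists_isClopen_of_connectedComponent_subset [CompactSpace X] {x : X} {U : Set X}
    (hU : IsOpen U) (h : connectedComponent x ⊆ U) : ∃ V, IsClopen V ∧ x ∈ V ∧ V ⊆ U := by
  let N := {V : Set X // IsClopen V ∧ x ∈ V}
  have : Nonempty N := ⟨⟨univ, isClopen_univ, mem_univ x⟩⟩
  have hdir : Directed (· ⊇ ·) fun V : N ↦ V.1 := fun V W ↦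
    ⟨⟨V.1 ∩ W.1, V.2.1.inter W.2.1, V.2.2, W.2.2⟩, inter_subset_left, inter_subset_right⟩
  have hnhds : ∀ y ∈ ⋂ V : N, V.1, U ∈ 𝓝 y := fun y hy ↦
    hU.mem_nhds (h (by rwa [connectedComponent_eq_iInter_isClopen]))
  obtain ⟨V, hVU⟩ := exists_subset_nhds_of_compactSpace hdir (fun V ↦ V.2.1.isClosed) hnhds
  exact ⟨V, V.2.1, V.2.2, hVU⟩

theorem exists_isOpen_isCompact_inter_of_connectedComponentIn_subset {Y U : Set X}
    (hY : IsCompact Y) (hU : IsOpen U) {x : X} (hx : x ∈ Y) (h : connectedComponentIn Y x ⊆ U) :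
    ∃ V, IsOpen V ∧ x ∈ V ∧ IsCompact (Y ∩ V) ∧ Y ∩ V ⊆ U := by
  have := isCompact_iff_compactSpace.1 hY
  rw [connectedComponentIn_eq_image hx, image_subset_iff] at h
  obtain ⟨W, hW, hxW, hWU⟩ :=
    exists_isClopen_of_connectedComponent_subset (hU.preimage continuous_subtype_val) h
  obtain ⟨V, hV, rfl⟩ := isOpen_induced_iff.1 hW.isOpen
  refine ⟨V, hV, hxW, ?_, fun y hy ↦ hWU (a := ⟨y, hy.1⟩) hy.2⟩
  simpa only [Subtype.image_preimage_coe] using hW.isClosed.isCompact.image continuous_subtype_val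

theorem nonempty_connectedComponentIn_inter_frontier {B U : Set X} (hB : IsCompact B)
    (hBc : IsPreconnected B) (hU : IsOpen U) {x : X} (hxB : x ∈ B) (hxU : x ∈ U) (hBU : ¬B ⊆ U) :
    (connectedComponentIn (B ∩ closure U) x ∩ frontier U).Nonempty := by
  by_contra hempty
  have hY : IsCompact (B ∩ closure U) := hB.inter_right isClosed_closure
  have hsub : connectedComponentIn (B ∩ closure U) x ⊆ U := fun y hy ↦ by
    by_contra hyU
    refine hempty ⟨y, hy, ?_⟩
    rw [hU.frontier_eq]
    exact ⟨(connectedComponentIn_subset _ _ hy).2, hyU⟩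
  obtain ⟨V, hV, hxV, hYV, hYVU⟩ :=
    exists_isOpen_isCompact_inter_of_connectedComponentIn_subset hY hU ⟨hxB, subset_closure hxU⟩
      hsub
  obtain ⟨b, hbB, hbU⟩ := not_subset.1 hBU
  obtain ⟨z, hzB, ⟨hzV, hzU⟩, hz⟩ := hBc (V ∩ U) (B ∩ closure U ∩ V)ᶜ (hV.inter hU)
    hYV.isClosed.isOpen_compl
    (fun y _ ↦ or_iff_not_imp_right.2 fun hy ↦ ⟨(not_not.1 hy).2, hYVU (not_not.1 hy)⟩)
    ⟨x, hxB, hxV, hxU⟩ ⟨b, hbB, fun hb ↦ hbU (hYVU hb)⟩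
  exact hz ⟨⟨hzB, subset_closure hzU⟩, hzV⟩

theorem exists_isConnected_isCompact_between {A B : Set X} (hA : IsCompact A)
    (hAc : IsConnected A) (hB : IsCompact B) (hBc : IsConnected B) (hAB : A ⊂ B) :
    ∃ C, IsCompact C ∧ IsConnected C ∧ A ⊂ C ∧ C ⊂ B := by
  obtain ⟨b, hbB, hbA⟩ := exists_of_ssubset hAB
  obtain ⟨a, ha⟩ := hAc.nonempty
  obtain ⟨U, W, hU, hW, hAU, hbW, hUW⟩ := SeparatedNhds.of_isCompact_isCompact hA
    isCompact_singleton (disjoint_singleton_right.2 hbA)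
  have hbU : b ∉ closure U := fun h ↦ disjoint_left.1 (hUW.closure_left hW) h (hbW rfl)
  have hAY : A ⊆ B ∩ closure U := subset_inter hAB.subset (hAU.trans subset_closure)
  have hCY := connectedComponentIn_subset (B ∩ closure U) a
  obtain ⟨z, hzC, hzU⟩ := nonempty_connectedComponentIn_inter_frontier hB hBc.isPreconnected hU
    (hAB.subset ha) (hAU ha) fun h ↦ hbU (subset_closure (h hbB))
  rw [hU.frontier_eq] at hzU
  exact ⟨_, isCompact_connectedComponentIn (hB.inter_right isClosed_closure) a,
    isConnected_connectedComponentIn_iff.2 (hAY ha),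
    ⟨hAc.isPreconnected.subset_connectedComponentIn ha hAY, fun h ↦ hzU.2 (hAU (h hzC))⟩,
    hCY.trans inter_subset_left, fun h ↦ hbU (hCY (h hbB)).2⟩

end BoundaryBumping

section Hyperspace

variable {X : Type*}

theorem isClosed_setOf_isConnected [TopologicalSpace X] [T2Space X] :
    IsClosed {K : NonemptyCompacts X | IsConnected (K : Set X)} := by
  rw [← isOpen_compl_iff, isOpen_iff_forall_mem_open]
  intro K hK
  have hK' : ¬IsPreconnected (K : Set X) := fun h ↦ hK ⟨K.nonempty, h⟩
  rw [isPreconnected_iff_subset_of_fully_disjoint_closed K.isCompact.isClosed] at hK'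
  push Not at hK'
  obtain ⟨u, v, hu, hv, hKuv, huv, hKu, hKv⟩ := hK'
  obtain ⟨U, V, hU, hV, huU, hvV, hUV⟩ :=
    SeparatedNhds.of_isCompact_isCompact (K.isCompact.inter_right hu)
      (K.isCompact.inter_right hv) (huv.mono inter_subset_right inter_subset_right)
  refine ⟨{L | (L : Set X) ⊆ U ∪ V} ∩
    ({L | ((L : Set X) ∩ U).Nonempty} ∩ {L | ((L : Set X) ∩ V).Nonempty}), ?_, ?_, ?_⟩
  · rintro L ⟨hL, hLU, hLV⟩ hLc
    obtain ⟨z, -, hzU, hzV⟩ := hLc.isPreconnected U V hU hV hL hLU hLV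
    exact disjoint_left.1 hUV hzU hzV
  · exact (NonemptyCompacts.isOpen_subsets_of_isOpen (hU.union hV)).inter
      ((NonemptyCompacts.isOpen_inter_nonempty_of_isOpen hU).inter
        (NonemptyCompacts.isOpen_inter_nonempty_of_isOpen hV))
  · obtain ⟨y, hyK, hyv⟩ := not_subset.1 hKv
    obtain ⟨z, hzK, hzu⟩ := not_subset.1 hKu
    exact ⟨fun w hw ↦ (hKuv hw).imp (fun h ↦ huU ⟨hw, h⟩) (fun h ↦ hvV ⟨hw, h⟩),
      ⟨y, hyK, huU ⟨hyK, (hKuv hyK).resolve_right hyv⟩⟩,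
      ⟨z, hzK, hvV ⟨hzK, (hKuv hzK).resolve_left hzu⟩⟩⟩

instance orderClosedTopology_nonemptyCompacts [TopologicalSpace X] [T2Space X] :
    OrderClosedTopology (NonemptyCompacts X) where
  isClosed_le' := by
    simp_rw [← sup_eq_right]
    exact isClosed_eq (continuous_fst.sup continuous_snd) continuous_snd

variable [PseudoMetricSpace X]

/-- The size of a compact set as seen by a sequence `u` of points: a weighted sum of the proximities
of the set to the points `u n`. It is a Whitney map up to the normalization on singletons, that is,
it is continuous, and it is strictly monotone on the subsets of `closure (range u)`. -/
noncomputable def proximitySize (u : ℕ → X) (K : NonemptyCompacts X) : ℝ :=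
  ∑' n, (1 / 2) ^ n * max 0 (1 - Metric.infDist (u n) K)

theorem proximitySize_term_le (u : ℕ → X) (n : ℕ) (K : NonemptyCompacts X) :
    (1 / 2 : ℝ) ^ n * max 0 (1 - Metric.infDist (u n) K) ≤ (1 / 2) ^ n :=
  mul_le_of_le_one_right (by positivity)
    (max_le zero_le_one (sub_le_self _ Metric.infDist_nonneg))

theorem summable_proximitySize (u : ℕ → X) (K : NonemptyCompacts X) :
    Summable fun n ↦ (1 / 2 : ℝ) ^ n * max 0 (1 - Metric.infDist (u n) K) :=
  .of_nonneg_of_le (fun n ↦ by positivity) (fun n ↦ proximitySize_term_le u n K)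
    summable_geometric_two

theorem proximitySize_lt {u : ℕ → X} {A B : NonemptyCompacts X} (hAB : A ≤ B) {b : X}
    (hbB : b ∈ B) (hbA : b ∉ closure (A : Set X)) (hbu : b ∈ closure (range u)) :
    proximitySize u A < proximitySize u B := by
  have hpos : 0 < Metric.infDist b (A : Set X) :=
    (Metric.infDist_pos_iff_notMem_closure A.nonempty).1 hbA
  obtain ⟨_, ⟨n, rfl⟩, hn⟩ :=
    Metric.mem_closure_iff.1 hbu (min 1 (Metric.infDist b (A : Set X) / 2)) (by positivity)
  have hB : Metric.infDist (u n) (B : Set X) ≤ dist b (u n) :=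
    dist_comm b (u n) ▸ Metric.infDist_le_dist_of_mem hbB
  have hA : Metric.infDist b (A : Set X) ≤ Metric.infDist (u n) (A : Set X) + dist b (u n) :=
    Metric.infDist_le_infDist_add_dist
  obtain ⟨hn1, hnA⟩ := lt_min_iff.1 hn
  refine Summable.tsum_lt_tsum (i := n) (fun m ↦ ?_) ?_ (summable_proximitySize u A)
    (summable_proximitySize u B)
  · have hm := Metric.infDist_le_infDist_of_subset (x := u m) hAB A.nonempty
    gcongr
  · gcongr
    exact max_lt (lt_max_of_lt_right (by linarith)) (lt_max_of_lt_right (by linarith))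

theorem continuous_proximitySize {X : Type*} [MetricSpace X] (u : ℕ → X) :
    Continuous (proximitySize u) := by
  refine continuous_tsum (fun n ↦ ?_) summable_geometric_two fun n K ↦ ?_
  · exact continuous_const.mul (continuous_const.max
      (continuous_const.sub (Metric.lipschitz_infDist_set (u n)).continuous))
  · rw [Real.norm_of_nonneg (by positivity)]
    exact proximitySize_term_le u n K

theorem strictMonoOn_proximitySize {X : Type*} [MetricSpace X] {u : ℕ → X} :
    StrictMonoOn (proximitySize u) {K | (K : Set X) ⊆ closure (range u)} := fun A _ B hB hAB ↦
  let ⟨_, hbB, hbA⟩ := exists_of_ssubset (show (A : Set X) ⊂ B from hAB)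
  proximitySize_lt hAB.le hbB (A.isCompact.isClosed.closure_eq.symm ▸ hbA) (hB hbB)

end Hyperspace

section ArcConn

variable {Y Z : Type*} [TopologicalSpace Y] [TopologicalSpace Z]

theorem IsArc.exists_isEmbedding {A : Set Y} (hA : IsArc A) :
    ∃ f : unitInterval → Y, IsEmbedding f ∧ range f = A := by
  obtain ⟨e⟩ := hA
  refine ⟨Subtype.val ∘ e.symm, IsEmbedding.subtypeVal.comp e.symm.isEmbedding, ?_⟩
  rw [e.symm.surjective.range_comp, Subtype.range_val]

theorem IsArc.image {A : Set Y} (hA : IsArc A) {f : Y → Z} (hf : IsEmbedding f) :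
    IsArc (f '' A) := by
  obtain ⟨e⟩ := hA
  exact ⟨(hf.homeomorphImage A).symm.trans e⟩

namespace ArcConn

theorem refl (y : Y) : ArcConn Y y y := Or.inl rfl

theorem symm {y z : Y} (h : ArcConn Y y z) : ArcConn Y z y :=
  h.imp Eq.symm fun ⟨A, hA, hy, hz⟩ ↦ ⟨A, hA, hz, hy⟩

theorem map {f : Y → Z} (hf : IsEmbedding f) {y z : Y} (h : ArcConn Y y z) :
    ArcConn Z (f y) (f z) :=
  h.imp (congrArg f) fun ⟨A, hA, hy, hz⟩ ↦
    ⟨f '' A, hA.image hf, mem_image_of_mem f hy, mem_image_of_mem f hz⟩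

theorem of_continuousOn_injOn [T2Space Y] {a b : ℝ} {f : ℝ → Y} (hab : a ≤ b)
    (hf : ContinuousOn f (Icc a b)) (hfi : InjOn f (Icc a b)) : ArcConn Y (f a) (f b) := by
  obtain rfl | hab := hab.eq_or_lt
  · exact refl _
  have hemb : IsEmbedding ((Icc a b).domRestrict f) :=
    ((continuousOn_iff_continuous_domRestrict.1 hf).isClosedEmbedding
      (injOn_iff_injective.1 hfi)).isEmbedding
  exact Or.inr ⟨range ((Icc a b).domRestrict f),
    ⟨hemb.toHomeomorph.symm.trans (iccHomeoI a b hab)⟩,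
    ⟨⟨a, left_mem_Icc.2 hab.le⟩, rfl⟩, ⟨⟨b, right_mem_Icc.2 hab.le⟩, rfl⟩⟩

theorem exists_continuousOn_injOn {y z : Y} (h : ArcConn Y y z) :
    ∃ (a b : ℝ) (f : ℝ → Y), a ≤ b ∧ ContinuousOn f (Icc a b) ∧ InjOn f (Icc a b) ∧
      f a = y ∧ f b = z := by
  obtain rfl | ⟨A, hA, hy, hz⟩ := h
  · exact ⟨0, 0, fun _ ↦ y, le_rfl, continuousOn_const, by simp, rfl, rfl⟩
  obtain ⟨f, hf, rfl⟩ := hA.exists_isEmbedding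
  obtain ⟨s, rfl⟩ := hy
  obtain ⟨t, rfl⟩ := hz
  clear hA
  wlog hst : s ≤ t generalizing f s t
  · simpa using this (f ∘ unitInterval.symmHomeomorph)
      (hf.comp unitInterval.symmHomeomorph.isEmbedding) (unitInterval.symm s)
      (unitInterval.symm t) (by simpa using le_of_not_ge hst)
  have hsub : Icc (s : ℝ) t ⊆ Icc 0 1 := Icc_subset_Icc s.2.1 t.2.2
  exact ⟨s, t, IccExtend zero_le_one f, hst, hf.continuous.Icc_extend'.continuousOn,
    (hf.injective.comp_injOn (strictMonoOn_projIcc zero_le_one).injOn).mono hsub,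
    IccExtend_val _ _ _, IccExtend_val _ _ _⟩

theorem concat [T2Space Y] {a b c d : ℝ} {f g : ℝ → Y} (hab : a ≤ b) (hcd : c ≤ d)
    (hf : ContinuousOn f (Icc a b)) (hfi : InjOn f (Icc a b)) (hg : ContinuousOn g (Icc c d))
    (hgi : InjOn g (Icc c d)) (hfg : f b = g c)
    (hdisj : Disjoint (f '' Ico a b) (g '' Icc c d)) : ArcConn Y (f a) (g d) := by
  let h : ℝ → Y := fun r ↦ if r < b then f r else g (r - b + c)
  have hle : b ≤ b + (d - c) := le_add_of_nonneg_right (sub_nonneg.2 hcd)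
  have hshift : MapsTo (fun r ↦ r - b + c) (Icc b (b + (d - c))) (Icc c d) := fun r hr ↦
    ⟨by linarith [hr.1], by linarith [hr.2]⟩
  have hhg : EqOn h (fun r ↦ g (r - b + c)) (Icc b (b + (d - c))) := fun r hr ↦
    if_neg hr.1.not_gt
  have hhf : EqOn h f (Icc a b) := fun r hr ↦ by
    obtain hrb | rfl := hr.2.lt_or_eq
    · exact if_pos hrb
    · simp only [hhg (left_mem_Icc.2 hle), sub_self, zero_add, hfg]
  have hhi : InjOn h (Icc a (b + (d - c))) := by
    rw [← Ico_union_Icc_eq_Icc hab hle, injOn_union]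
    · refine ⟨(hfi.mono Ico_subset_Icc_self).congr (hhf.mono Ico_subset_Icc_self).symm,
        (hgi.comp (fun _ _ _ _ ↦ by simp) hshift).congr hhg.symm, fun p hp q hq hpq ↦ ?_⟩
      rw [hhf (Ico_subset_Icc_self hp), hhg hq] at hpq
      exact disjoint_left.1 hdisj (mem_image_of_mem f hp) ⟨_, hshift hq, hpq.symm⟩
    · exact disjoint_left.2 fun r hr hr' ↦ hr.2.not_ge hr'.1
  have hhc : ContinuousOn h (Icc a (b + (d - c))) := by
    rw [← Icc_union_Icc_eq_Icc hab hle]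
    exact (hf.congr hhf).union_of_isClosed
      ((hg.comp (by fun_prop) hshift).congr hhg) isClosed_Icc isClosed_Icc
  have := of_continuousOn_injOn (hab.trans hle) hhc hhi
  simpa only [hhf (left_mem_Icc.2 hab), hhg (right_mem_Icc.2 hle), add_sub_cancel_left,
    sub_add_cancel] using this

theorem trans [T2Space Y] {x y z : Y} (hxy : ArcConn Y x y) (hyz : ArcConn Y y z) :
    ArcConn Y x z := by
  obtain ⟨a, b, f, hab, hf, hfi, rfl, rfl⟩ := hxy.exists_continuousOn_injOn
  obtain ⟨c, d, g, hcd, hg, hgi, hgc, rfl⟩ := hyz.exists_continuousOn_injOn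
  -- Follow `f` only up to the first time `t` at which it hits the second arc.
  have hgcl : IsClosed (g '' Icc c d) := (isCompact_Icc.image_of_continuousOn hg).isClosed
  obtain ⟨t, ⟨ht, s, hs, hst⟩, hmin⟩ :=
    (isCompact_Icc.of_isClosed_subset (hf.preimage_isClosed_of_isClosed isClosed_Icc hgcl)
      inter_subset_left).exists_isLeast ⟨b, right_mem_Icc.2 hab, c, left_mem_Icc.2 hcd, hgc⟩
  have hat : Icc a t ⊆ Icc a b := Icc_subset_Icc_right ht.2
  have hsd : Icc s d ⊆ Icc c d := Icc_subset_Icc_left hs.1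
  refine concat ht.1 hs.2 (hf.mono hat) (hfi.mono hat) (hg.mono hsd) (hgi.mono hsd) hst.symm
    (disjoint_left.2 ?_)
  rintro _ ⟨r, hr, rfl⟩ hrg
  exact hr.2.not_ge (hmin ⟨hat (Ico_subset_Icc_self hr), image_mono hsd hrg⟩)

end ArcConn

end ArcConn

section MaximalChains

theorem Icc_subset_of_isClosed_of_forall_exists_between {R : Type*}
    [ConditionallyCompleteLinearOrder R] [TopologicalSpace R] [OrderTopology R] {s : Set R}
    (hs : IsClosed s) (hbetween : ∀ x ∈ s, ∀ y ∈ s, x < y → ∃ z ∈ s, x < z ∧ z < y) {a b : R}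
    (ha : a ∈ s) (hb : b ∈ s) : Icc a b ⊆ s := by
  intro t ht
  have hbelow : BddAbove (s ∩ Iic t) := bddAbove_Iic.mono inter_subset_right
  have habove : BddBelow (s ∩ Ici t) := bddBelow_Ici.mono inter_subset_right
  obtain ⟨hps, hpt⟩ := (hs.inter isClosed_Iic).csSup_mem ⟨a, ha, ht.1⟩ hbelow
  obtain ⟨hqs, htq⟩ := (hs.inter isClosed_Ici).csInf_mem ⟨b, hb, ht.2⟩ habove
  by_contra hts
  obtain ⟨z, hzs, hpz, hzq⟩ := hbetween _ hps _ hqs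
    ((lt_of_le_of_ne hpt fun h ↦ hts (h ▸ hps)).trans_le htq)
  rcases le_total z t with hzt | htz
  · exact hpz.not_ge (le_csSup hbelow ⟨hzs, hzt⟩)
  · exact hzq.not_ge (csInf_le habove ⟨hzs, htz⟩)

theorem range_eq_Icc_of_continuous_of_strictMono {L R : Type*} [LinearOrder L]
    [TopologicalSpace L] [CompactSpace L] [DenselyOrdered L] [BoundedOrder L]
    [ConditionallyCompleteLinearOrder R] [TopologicalSpace R] [OrderTopology R] {μ : L → R}
    (hμ : Continuous μ) (hmono : StrictMono μ) : range μ = Icc (μ ⊥) (μ ⊤) := by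
  refine Subset.antisymm (range_subset_iff.2 fun x ↦
    ⟨hmono.monotone bot_le, hmono.monotone le_top⟩)
    (Icc_subset_of_isClosed_of_forall_exists_between (isCompact_range hμ).isClosed ?_
      (mem_range_self ⊥) (mem_range_self ⊤))
  rintro _ ⟨x, rfl⟩ _ ⟨y, rfl⟩ hxy
  obtain ⟨z, hxz, hzy⟩ := exists_between (hmono.lt_iff_lt.1 hxy)
  exact ⟨μ z, mem_range_self z, hmono hxz, hmono hzy⟩

variable {T : Type*} [PartialOrder T]

instance denselyOrdered_flag [DenselyOrdered T] (F : Flag T) : DenselyOrdered F :=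
  denselyOrdered_iff_forall_not_covBy.2 fun _ _ h ↦ not_covBy (Flag.coe_covBy_coe.2 h)

variable [TopologicalSpace T] [OrderClosedTopology T]

theorem isClosed_flag (F : Flag T) : IsClosed (F : Set T) := by
  have hF : (F : Set T) = ⋂ x ∈ F, Iic x ∪ Ici x := by
    ext y
    simpa only [mem_iInter, mem_union, mem_Iic, mem_Ici, SetLike.mem_coe] using
      F.mem_iff_forall_le_or_ge
  rw [hF]
  exact isClosed_biInter fun x _ ↦ isClosed_Iic.union isClosed_Ici

theorem isArc_flag [CompactSpace T] [DenselyOrdered T] [BoundedOrder T] [Nontrivial T]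
    {μ : T → ℝ} (hμ : Continuous μ) (hmono : StrictMono μ) (F : Flag T) :
    IsArc (F : Set T) := by
  classical
  have := isCompact_iff_compactSpace.1 (isClosed_flag F).isCompact
  have hμF : Continuous fun x : F ↦ μ x := hμ.comp continuous_subtype_val
  have hmonoF : StrictMono fun x : F ↦ μ x := fun _ _ hxy ↦ hmono hxy
  have hemb : IsClosedEmbedding fun x : F ↦ μ x := hμF.isClosedEmbedding hmonoF.injective
  have hrange : range (fun x : F ↦ μ x) = Icc (μ ⊥) (μ ⊤) :=
    range_eq_Icc_of_continuous_of_strictMono hμF hmonoF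
  exact ⟨hemb.isEmbedding.toHomeomorph.trans
    ((Homeomorph.setCongr hrange).trans (iccHomeoI _ _ (hmono bot_lt_top)))⟩

theorem arcConn_bot_top [CompactSpace T] [DenselyOrdered T] [BoundedOrder T]
    {μ : T → ℝ} (hμ : Continuous μ) (hmono : StrictMono μ) : ArcConn T ⊥ ⊤ := by
  cases subsingleton_or_nontrivial T
  · exact Or.inl (Subsingleton.elim _ _)
  · let F : Flag T := Classical.arbitrary _
    exact Or.inr ⟨F, isArc_flag hμ hmono F, F.bot_mem, F.top_mem⟩

theorem arcConn_of_le [DenselyOrdered T] {a b : T} (hab : a ≤ b)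
    (hcompact : IsCompact (Icc a b)) {μ : T → ℝ} (hμ : ContinuousOn μ (Icc a b))
    (hmono : StrictMonoOn μ (Icc a b)) : ArcConn T a b := by
  have := isCompact_iff_compactSpace.1 hcompact
  have : Fact (a ≤ b) := ⟨hab⟩
  have hmono' : StrictMono (Icc a b |>.domRestrict μ) := fun x y hxy ↦ hmono x.2 y.2 hxy
  exact (arcConn_bot_top (continuousOn_iff_continuous_domRestrict.1 hμ) hmono').map
    IsEmbedding.subtypeVal

end MaximalChains

section SmallContinua

variable {X : Type*} [MetricSpace X] {ε : ℝ}

theorem singleton_mem_smallContinua (hε : 0 < ε) (x : X) : {x} ∈ smallContinua X ε := by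
  simpa [smallContinua, isConnected_singleton] using hε

theorem mem_smallContinua_of_le {K L : NonemptyCompacts X} (hL : L ∈ smallContinua X ε)
    (hK : IsConnected (K : Set X)) (hKL : K ≤ L) : K ∈ smallContinua X ε :=
  ⟨hK, (Metric.diam_mono hKL L.isCompact.isBounded).trans_lt hL.2⟩

instance denselyOrdered_smallContinua : DenselyOrdered (smallContinua X ε) where
  dense A B hAB := by
    obtain ⟨C, hC, hCc, hAC, hCB⟩ := exists_isConnected_isCompact_between A.1.isCompact A.2.1
      B.1.isCompact B.2.1 (show (A.1 : Set X) ⊂ B.1 from hAB)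
    exact ⟨⟨⟨⟨C, hC⟩, hCc.nonempty⟩, mem_smallContinua_of_le B.2 hCc hCB.le⟩, hAC, hCB⟩

theorem isCompact_Icc_smallContinua (A B : smallContinua X ε) : IsCompact (Icc A B) := by
  have himage : Subtype.val '' Icc A B =
      {K : NonemptyCompacts X | (K : Set X) ⊆ B.1} ∩ {K | IsConnected (K : Set X)} ∩ Ici A.1 := by
    ext K
    constructor
    · rintro ⟨K, ⟨hAK, hKB⟩, rfl⟩
      exact ⟨⟨hKB, K.2.1⟩, hAK⟩
    · rintro ⟨⟨hKB, hK⟩, hAK⟩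
      exact ⟨⟨K, mem_smallContinua_of_le B.2 hK hKB⟩, ⟨hAK, hKB⟩, rfl⟩
  rw [Subtype.isCompact_iff, himage]
  exact ((NonemptyCompacts.isCompact_subsets_of_isCompact B.1.isCompact).inter_right
    isClosed_setOf_isConnected).inter_right isClosed_Ici

theorem arcConn_smallContinua_of_le {A B : smallContinua X ε} (hAB : A ≤ B) :
    ArcConn (smallContinua X ε) A B := by
  obtain ⟨c, hc, hBc⟩ := B.1.isCompact.isSeparable
  obtain ⟨u, rfl⟩ := hc.exists_eq_range (closure_nonempty_iff.1 (B.1.nonempty.mono hBc))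
  refine arcConn_of_le hAB (isCompact_Icc_smallContinua A B)
    ((continuous_proximitySize u).comp continuous_subtype_val).continuousOn
    fun K hK L hL hKL ↦ strictMonoOn_proximitySize (Subset.trans hK.2 hBc)
      (Subset.trans hL.2 hBc) hKL

/-- Two small continua meet: the adjacency relation whose finite chains define
`EpsChainConn`. -/
def ContinuaMeet (K L : smallContinua X ε) : Prop :=
  ((K.1 : Set X) ∩ L.1).Nonempty

theorem ContinuaMeet.symm {K L : smallContinua X ε} (h : ContinuaMeet K L) : ContinuaMeet L K :=
  let ⟨z, hzK, hzL⟩ := h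
  ⟨z, hzL, hzK⟩

theorem ContinuaMeet.of_le {K L : smallContinua X ε} (h : K ≤ L) : ContinuaMeet K L :=
  let ⟨z, hz⟩ := K.1.nonempty
  ⟨z, hz, h hz⟩

theorem ContinuaMeet.arcConn {K L : smallContinua X ε} (h : ContinuaMeet K L) :
    ArcConn (smallContinua X ε) K L := by
  obtain ⟨z, hzK, hzL⟩ := h
  have hε : 0 < ε := Metric.diam_nonneg.trans_lt K.2.2
  let z' : smallContinua X ε := ⟨{z}, singleton_mem_smallContinua hε z⟩
  have hzK' : z' ≤ K := singleton_subset_iff.2 hzK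
  have hzL' : z' ≤ L := singleton_subset_iff.2 hzL
  exact (arcConn_smallContinua_of_le hzK').symm.trans (arcConn_smallContinua_of_le hzL')

theorem arcConn_of_reflTransGen {K L : smallContinua X ε}
    (h : Relation.ReflTransGen ContinuaMeet K L) : ArcConn (smallContinua X ε) K L := by
  induction h with
  | refl => exact .refl K
  | tail _ h ih => exact ih.trans h.arcConn

end SmallContinua

section Paths

variable {T : Type*} [TopologicalSpace T]

theorem isCompact_biUnion_nonemptyCompacts {X : Type*} [TopologicalSpace X] {V : Set T}
    (hV : IsCompact V) {F : T → NonemptyCompacts X} (hF : Continuous F) :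
    IsCompact (⋃ t ∈ V, (F t : Set X)) := by
  simpa only [biUnion_image] using
    NonemptyCompacts.isCompact_biUnion_coe_of_isCompact (hV.image hF)

theorem isConnected_biUnion_nonemptyCompacts {X : Type*} [TopologicalSpace X] {V : Set T}
    (hV : IsConnected V) {F : T → NonemptyCompacts X} (hF : Continuous F)
    (hconn : ∀ t, IsConnected (F t : Set X)) : IsConnected (⋃ t ∈ V, (F t : Set X)) := by
  obtain ⟨s, hs⟩ := hV.nonempty
  let _ := TopologicalSpace.vietoris X
  exact ⟨(hconn s).nonempty.mono (subset_biUnion_of_mem hs),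
    vietoris.isPreconnected_biUnion hV.isPreconnected
      (NonemptyCompacts.continuous_coe.comp hF).continuousOn ⟨s, hs, (hconn s).isPreconnected⟩⟩

variable {X : Type*} [MetricSpace X] {ε : ℝ}

theorem exists_isOpen_superset_diam_lt {K : Set X} (hK : Bornology.IsBounded K)
    (hdiam : Metric.diam K < ε) :
    ∃ U, IsOpen U ∧ K ⊆ U ∧ Bornology.IsBounded U ∧ Metric.diam U < ε := by
  obtain ⟨δ, hδ, hδε⟩ : ∃ δ > 0, Metric.diam K + 2 * δ < ε :=
    ⟨(ε - Metric.diam K) / 4, by linarith, by linarith⟩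
  exact ⟨Metric.thickening δ K, Metric.isOpen_thickening, Metric.self_subset_thickening hδ K,
    hK.thickening, (Metric.diam_thickening_le K hδ.le).trans_lt hδε⟩

theorem eventually_exists_smallContinua_ge [LocallyCompactSpace T]
    [LocallyConnectedSpace T] {F : T → smallContinua X ε} (hF : Continuous F) (s : T) :
    ∀ᶠ t in 𝓝 s, ∃ M : smallContinua X ε, F s ≤ M ∧ F t ≤ M := by
  have hF' : Continuous fun t ↦ (F t).1 := continuous_subtype_val.comp hF
  obtain ⟨U, hU, hFU, hUb, hUε⟩ :=
    exists_isOpen_superset_diam_lt (F s).1.isCompact.isBounded (F s).2.2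
  have hnhds : {t | ((F t).1 : Set X) ⊆ U} ∈ 𝓝 s :=
    ((NonemptyCompacts.isOpen_subsets_of_isOpen hU).preimage hF').mem_nhds hFU
  obtain ⟨N, hN, hNU, hNc⟩ := local_compact_nhds hnhds
  have hs : s ∈ N := mem_of_mem_nhds hN
  have hV : IsConnected (connectedComponentIn N s) := isConnected_connectedComponentIn_iff.2 hs
  have hM : IsConnected (⋃ t ∈ connectedComponentIn N s, ((F t).1 : Set X)) :=
    isConnected_biUnion_nonemptyCompacts hV hF' fun t ↦ (F t).2.1
  have hMU : (⋃ t ∈ connectedComponentIn N s, ((F t).1 : Set X)) ⊆ U :=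
    iUnion₂_subset fun t ht ↦ hNU (connectedComponentIn_subset N s ht)
  let M : smallContinua X ε :=
    ⟨⟨⟨_, isCompact_biUnion_nonemptyCompacts (isCompact_connectedComponentIn hNc s) hF'⟩,
      hM.nonempty⟩, hM, (Metric.diam_mono hMU hUb).trans_lt hUε⟩
  have hFM : ∀ t ∈ connectedComponentIn N s, F t ≤ M := fun t ht ↦
    subset_biUnion_of_mem (u := fun t ↦ ((F t).1 : Set X)) ht
  filter_upwards [connectedComponentIn_mem_nhds hN] with t ht
  exact ⟨M, hFM s (mem_connectedComponentIn hs), hFM t ht⟩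

theorem reflTransGen_continuaMeet_of_continuous [LocallyCompactSpace T]
    [LocallyConnectedSpace T] [PreconnectedSpace T] {F : T → smallContinua X ε}
    (hF : Continuous F) (s t : T) : Relation.ReflTransGen ContinuaMeet (F s) (F t) := by
  refine PreconnectedSpace.induction₂' (fun p q ↦ Relation.ReflTransGen ContinuaMeet (F p) (F q))
    (fun p ↦ ?_) ⟨fun _ _ _ ↦ Relation.ReflTransGen.trans⟩ s t
  filter_upwards [eventually_exists_smallContinua_ge hF p] with q ⟨M, hpM, hqM⟩
  have hp := ContinuaMeet.of_le hpM
  have hq := ContinuaMeet.of_le hqM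
  exact ⟨.tail (.single hp) hq.symm, .tail (.single hq) hp.symm⟩

theorem ArcConn.reflTransGen_continuaMeet {K L : smallContinua X ε}
    (h : ArcConn (smallContinua X ε) K L) : Relation.ReflTransGen ContinuaMeet K L := by
  obtain rfl | ⟨A, hA, hKA, hLA⟩ := h
  · exact .refl
  obtain ⟨f, hf, rfl⟩ := hA.exists_isEmbedding
  obtain ⟨s, rfl⟩ := hKA
  obtain ⟨t, rfl⟩ := hLA
  have : LocallyPathConnectedSpace unitInterval := (convex_Icc 0 1).locallyPathConnectedSpace
  exact reflTransGen_continuaMeet_of_continuous hf.continuous s t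

end Paths

section Chains

variable {X : Type*} [MetricSpace X] {ε : ℝ} {x y : X}

theorem reflTransGen_continuaMeet_of_fin {k : ℕ} {K : Fin (k + 1) → smallContinua X ε}
    (hK : ∀ i : Fin k, ContinuaMeet (K i.castSucc) (K i.succ)) :
    Relation.ReflTransGen ContinuaMeet (K 0) (K (Fin.last k)) :=
  Fin.induction .refl (fun i hi ↦ hi.tail (hK i)) (Fin.last k)

theorem exists_fin_of_reflTransGen_continuaMeet {K L : smallContinua X ε}
    (h : Relation.ReflTransGen ContinuaMeet K L) :
    ∃ (k : ℕ) (M : Fin (k + 1) → smallContinua X ε), M 0 = K ∧ M (Fin.last k) = L ∧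
      ∀ i : Fin k, ContinuaMeet (M i.castSucc) (M i.succ) := by
  induction h using Relation.ReflTransGen.head_induction_on with
  | refl => exact ⟨0, fun _ ↦ L, rfl, rfl, fun i ↦ i.elim0⟩
  | @head K _ hKM _ ih =>
    obtain ⟨k, M, rfl, hML, hM⟩ := ih
    exact ⟨k + 1, Fin.cons K M, rfl, hML, Fin.cases hKM hM⟩

theorem epsChainConn_iff_exists_reflTransGen : EpsChainConn X ε x y ↔
    ∃ K L : smallContinua X ε, x ∈ K.1 ∧ y ∈ L.1 ∧ Relation.ReflTransGen ContinuaMeet K L := by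
  constructor
  · rintro ⟨k, K, hK, hx, hy, hKK⟩
    exact ⟨⟨K 0, hK 0⟩, ⟨K (Fin.last k), hK _⟩, hx, hy,
      reflTransGen_continuaMeet_of_fin (K := fun i ↦ ⟨K i, hK i⟩) hKK⟩
  · rintro ⟨K, L, hx, hy, hKL⟩
    obtain ⟨k, M, rfl, rfl, hM⟩ := exists_fin_of_reflTransGen_continuaMeet hKL
    exact ⟨k, fun i ↦ M i, fun i ↦ (M i).2, hx, hy, hM⟩

theorem arcConn_iff_epsChainConn {K L : smallContinua X ε} (hx : x ∈ K.1) (hy : y ∈ L.1) :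
    ArcConn (smallContinua X ε) K L ↔ EpsChainConn X ε x y := by
  rw [epsChainConn_iff_exists_reflTransGen]
  refine ⟨fun h ↦ ⟨K, L, hx, hy, h.reflTransGen_continuaMeet⟩, ?_⟩
  rintro ⟨M, N, hxM, hyN, hMN⟩
  have hKM : ContinuaMeet K M := ⟨x, hx, hxM⟩
  have hNL : ContinuaMeet N L := ⟨y, hyN, hy⟩
  exact arcConn_of_reflTransGen (.head hKM (hMN.tail hNL))

theorem EpsChainConn.mono {δ : ℝ} (hεδ : ε ≤ δ) (h : EpsChainConn X ε x y) :
    EpsChainConn X δ x y :=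
  let ⟨k, K, hK, hxy⟩ := h
  ⟨k, K, fun i ↦ ⟨(hK i).1, (hK i).2.trans_le hεδ⟩, hxy⟩

theorem chainConn_iff_forall_nat :
    ChainConn X x y ↔ ∀ n : ℕ, EpsChainConn X (1 / ((n : ℝ) + 1)) x y := by
  refine ⟨fun h n ↦ h _ Nat.one_div_pos_of_nat, fun h ε hε ↦ ?_⟩
  obtain ⟨n, hn⟩ := exists_nat_one_div_lt hε
  exact (h n).mono hn.le

theorem interArcConn_iff_chainConn {K L : ↥(⋂ n : ℕ, smallContinua X (1 / ((n : ℝ) + 1)))}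
    (hx : x ∈ K.1) (hy : y ∈ L.1) : InterArcConn X K L ↔ ChainConn X x y := by
  rw [chainConn_iff_forall_nat]
  exact forall_congr' fun n ↦ arcConn_iff_epsChainConn hx hy

end Chains

section BorelSelector

variable {X Q : Type*} [TopologicalSpace X] [TopologicalSpace Q]

theorem exists_isLeast_mem_image {C : Set ℝ} (hC : IsCompact C) {q : C → Q} (hq : Continuous q)
    (hqsurj : Function.Surjective q) {K : Set Q} (hK : IsClosed K) (hKne : K.Nonempty) :
    ∃ t : C, IsLeast (q ⁻¹' K) t := by
  have := isCompact_iff_compactSpace.1 hC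
  exact (hK.preimage hq).isCompact.exists_isLeast (hKne.preimage hqsurj)

theorem exists_measurable_selector_of_isEmbedding [MeasurableSpace X] [BorelSpace X] [T2Space Q]
    {C : Set ℝ} (hC : IsCompact C) {q : C → Q} (hq : Continuous q) (hqsurj : Function.Surjective q)
    {ι : X → Q} (hι : IsEmbedding ι) :
    ∃ g : NonemptyCompacts X → X, Measurable g ∧ ∀ K, g K ∈ K := by
  have := isCompact_iff_compactSpace.1 hC
  choose h hhK hmin using fun K : NonemptyCompacts X ↦ exists_isLeast_mem_image hC hq hqsurj
    (K.isCompact.image hι.continuous).isClosed (K.nonempty.image ι)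
  have hh : Measurable h := by
    refine (measurable_of_Iic (f := fun K ↦ (h K : ℝ)) fun a ↦ ?_).subtype_mk
    have hIic : (fun K ↦ (h K : ℝ)) ⁻¹' Iic a =
        {K : NonemptyCompacts X |
          ((K : Set X) ∩ ι ⁻¹' (q '' {t | (t : ℝ) ≤ a})).Nonempty} := by
      ext K
      constructor
      · intro hKa
        obtain ⟨x, hx, hxK⟩ := hhK K
        exact ⟨x, hx, h K, hKa, hxK.symm⟩
      · rintro ⟨x, hx, t, hta, htx⟩
        exact (Subtype.coe_le_coe.2 (hmin K ⟨x, hx, htx.symm⟩)).trans hta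
    rw [hIic]
    exact (NonemptyCompacts.isClosed_inter_nonempty_of_isClosed
      (((isClosed_Iic.preimage continuous_subtype_val).isCompact.image hq).isClosed.preimage
        hι.continuous)).measurableSet
  choose g hgK hg using hhK
  refine ⟨g, measurable_of_isOpen fun U hU ↦ ?_, hgK⟩
  obtain ⟨V, hV, rfl⟩ := hι.isOpen_iff.1 hU
  have hgV : g ⁻¹' (ι ⁻¹' V) = h ⁻¹' (q ⁻¹' V) := by
    ext K
    simp only [mem_preimage, hg]
  rw [hgV]
  exact hh (hV.preimage hq).measurableSet

theorem exists_measurable_selector (X : Type*) [MetricSpace X] [SeparableSpace X]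
    [MeasurableSpace X] [BorelSpace X] :
    ∃ g : NonemptyCompacts X → X, Measurable g ∧ ∀ K, g K ∈ K := by
  obtain ⟨ι, hι⟩ := Metric.PiNatEmbed.exists_embedding_to_hilbert_cube (X := X)
  exact exists_measurable_selector_of_isEmbedding isCompact_cantorSet
    (cantorToHilbert_continuous.comp cantorSetHomeomorphNatToBool.continuous)
    (cantorToHilbert_surjective.comp cantorSetHomeomorphNatToBool.surjective) hι

end BorelSelector

theorem borelBireducible_of_forall_mem {X : Type*} [MetricSpace X] [SeparableSpace X]
    [MeasurableSpace X] [BorelSpace X] {S : Set (NonemptyCompacts X)} (hS : ∀ x, {x} ∈ S)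
    {E : X → X → Prop} {F : S → S → Prop}
    (hEF : ∀ K L x y, x ∈ K.1 → y ∈ L.1 → (F K L ↔ E x y)) : BorelBireducible E F := by
  obtain ⟨g, hg, hgK⟩ := exists_measurable_selector X
  have hsingleton : Measurable fun x : X ↦ (⟨{x}, hS x⟩ : S) :=
    NonemptyCompacts.continuous_singleton.measurable.subtype_mk
  exact ⟨⟨_, hsingleton, fun x y ↦ (hEF ⟨{x}, hS x⟩ ⟨{y}, hS y⟩ x y rfl rfl).symm⟩,
    ⟨fun K ↦ g K.1, hg.comp measurable_subtype_coe, fun K L ↦ hEF K L _ _ (hgK _) (hgK _)⟩⟩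

theorem mainTheorem5_general (X : Type*) [MetricSpace X] [SeparableSpace X]
    [MeasurableSpace X] [BorelSpace X] :
    (∀ ε : ℝ, 0 < ε →
      BorelBireducible (EpsChainConn X ε) (ArcConn (smallContinua X ε))) ∧
    BorelBireducible (ChainConn X) (InterArcConn X) :=
  ⟨fun _ hε ↦ borelBireducible_of_forall_mem (singleton_mem_smallContinua hε)
      fun _ _ _ _ ↦ arcConn_iff_epsChainConn,
    borelBireducible_of_forall_mem
      (fun x ↦ mem_iInter.2 fun _ ↦ singleton_mem_smallContinua Nat.one_div_pos_of_nat x)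
      fun _ _ _ _ ↦ interArcConn_iff_chainConn⟩

theorem mainTheorem5 (X : Type*) [MetricSpace X] [PolishSpace X]
    [MeasurableSpace X] [BorelSpace X] :
    (∀ ε : ℝ, 0 < ε →
      BorelBireducible (EpsChainConn X ε) (ArcConn (smallContinua X ε))) ∧
    BorelBireducible (ChainConn X) (InterArcConn X) :=
  mainTheorem5_general X
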